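/- Let $k\ge 2$, $Z_k=\{0,\dots,k-1\}$, and let $f:Z_k^n\to Z_k$. A variable $x_i$ is essential in $f$ if changing the value of the $i$-th argument alone can change the value of $f$; $\mathrm{Ess}(f)$ is the set of essential variables of $f$ and $\mathrm{ess}(f)=|\mathrm{Ess}(f)|$. A simple subfunction of $f$ is a function $f(x_i=c)$ obtained by assigning a constant $c\in Z_k$ to an essential variable $x_i$ of $f$ (regarded as an $n$-ary function not depending on $x_i$). A subfunction of $f$ is a function obtained from $f$ by finitely many (possibly zero) successive passages to a simple subfunction. A non-empty set $M\subseteq\mathrm{Ess}(f)$ is separable in $f$ if there is a subfunction $g$ of $f$ with $\mathrm{Ess}(g)=M$. A simple identification minor of $f$ is a function $f_{i\leftarrow j}$ obtained by replacing the $i$-th argument of $f$ by the $j$-th one, where $x_i,x_j$ are distinct essential variables of $f$. Let $\mathrm{Mnr}(f)$ be the set of functions obtained from $f$ by one or more successive passages to a simple identification minor. If $\mathrm{ess}(f)\ge 2$, the essential arity gap of $f$ is $$\mathrm{gap}(f)=\mathrm{ess}(f)-\max_{h\in \mathrm{Mnr}(f)}\mathrm{ess}(h);$$ if $\mathrm{ess}(f)\le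 1$, so that $\mathrm{Mnr}(f)=\emptyset$, the maximum is read as $0$. **Theorem.** If $\mathrm{gap}(f)\ge 2$, then every non-empty set $M\subseteq \mathrm{Ess}(f)$ is separable in $f$. -/

import Mathlib

namespace KValued

/-- An `n`-ary `k`-valued function `f : Z_k ^ n → Z_k`, where `Z_k = {0, …, k - 1}`. The variable
`x_i` is represented by its index `i : Fin n`. -/
abbrev Op (k n : ℕ) : Type := (Fin n → Fin k) → Fin k

variable {k n : ℕ}

/-- The variable `x_i` is essential in `f`: changing only the `i`-th argument, at some point, to
some value `b`, changes the value of `f`. -/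
def IsEssential (f : Op k n) (i : Fin n) : Prop :=
  ∃ (a : Fin n → Fin k) (b : Fin k), f a ≠ f (Function.update a i b)

open Classical in
/-- The set `Ess(f)` of all essential variables of `f`. -/
noncomputable def Ess (f : Op k n) : Finset (Fin n) :=
  Finset.univ.filter (fun i => IsEssential f i)

/-- `ess(f) = |Ess(f)|`. -/
noncomputable def ess (f : Op k n) : ℕ := (Ess f).card

/-- `f(x_i = c)`: the constant `c` is assigned to `x_i`. It is regarded as a function of the same
arity in which `x_i` is fictive. -/
def assign (f : Op k n) (i : Fin n) (c : Fin k) : Op k n :=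
  fun a => f (Function.update a i c)

/-- `g` is a simple subfunction of `f`: `g = f(x_i = c)` for an essential variable `x_i` of `f`. -/
def SimpleSubfunction (f g : Op k n) : Prop :=
  ∃ i ∈ Ess f, ∃ c : Fin k, g = assign f i c

/-- `g` is a subfunction of `f`: it is reached from `f` by finitely many (possibly no) passages to
a simple subfunction. In particular `f` is a subfunction of itself. -/
def Subfunction (f g : Op k n) : Prop :=
  Relation.ReflTransGen SimpleSubfunction f g

/-- A non-empty set `M` of essential variables of `f` is separable in `f` if `M = Ess(g)` for some
subfunction `g` of `f`. -/
def Separable (f : Op k n) (M : Finset (Fin n)) : Prop :=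
  M.Nonempty ∧ M ⊆ Ess f ∧ ∃ g : Op k n, Subfunction f g ∧ Ess g = M

/-- `f_{i ← j}`: the `i`-th argument of `f` is replaced by the `j`-th one. -/
def identify (f : Op k n) (i j : Fin n) : Op k n :=
  fun a => f (Function.update a i (a j))

/-- `h` is a simple identification minor of `f`: `h = f_{i ← j}` for two distinct essential
variables `x_i`, `x_j` of `f`. -/
def SimpleMinor (f h : Op k n) : Prop :=
  ∃ i ∈ Ess f, ∃ j ∈ Ess f, i ≠ j ∧ h = identify f i j

/-- `Mnr(f)`: the functions reached from `f` by at least one identification of two distinct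
essential variables. -/
def Mnr (f : Op k n) : Set (Op k n) :=
  {h | Relation.TransGen SimpleMinor f h}

/-- The essential arity gap `gap(f) = ess(f) - max {ess(h) | h ∈ Mnr(f)}`. The set of the values
`ess(h)` is bounded by `ess(f)`, so that the supremum is a maximum as soon as `f` has a minor, that
is, as soon as `ess(f) ≥ 2`. If `ess(f) ≤ 1` the value is `ess(f)`, hence at most `1`. -/
noncomputable def gap (f : Op k n) : ℕ :=
  ess f - sSup (ess '' Mnr f)

end KValued

/-! Discard the inessential arguments. A gap of at least 2 then says that on each hyperplane `x p =
x q` either the common value is irrelevant (`BlockFree`) or some further argument is (`FreeOn`).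
Separability of M asks for constants outside M that keep all of M essential (`Rich`). Only a proper
M with at least two members needs work, so there are at least three arguments.

Two mechanisms give richness. If f is symmetric at repeat points (points with a repeated coordinate)
and varies along a line joining two of them, transpositions carry this variation to every direction
in M. If f agrees at repeat points with some h missing two arguments, a point where f and h differ
supplies the constants (`rich_of_eq_on_repeats`).

If every pair is block-free, f is symmetric at repeat points. Otherwise take a pair p, q that is not
block-free and has the fewest free arguments. Minimality forces `BlockFree f p m` or `FreeOn f p m
q` for each free m, and likewise with p and q exchanged. If a block-free alternative occurs, say at
p, then `x p` may be replaced by `x q` at every repeat point and the second mechanism applies,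
except in one configuration of three arguments, settled by explicit constants. If none occurs, three
arguments give a majority-like symmetry, while a fourth forces `BlockFree f p q`, a contradiction.
-/

namespace ArityGap

open Function

/-! ### Two sources of richness: agreement and symmetry at repeat points. -/

section Hyperplanes

variable {ι A B : Type*}

/-- `f` does not depend on the argument `m`. -/
def Misses (f : (ι → A) → B) (m : ι) : Prop :=
  ∀ x y : ι → A, (∀ i, i ≠ m → x i = y i) → f x = f y

/-- On the hyperplane `x p = x q` the value of `f` does not depend on the argument `m`. -/
def FreeOn (f : (ι → A) → B) (p q m : ι) : Prop :=
  ∀ x y : ι → A, x p = x q → y p = y q → (∀ i, i ≠ m → x i = y i) → f x = f y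

/-- On the hyperplane `x p = x q` the value of `f` does not depend on the common value of the
arguments `p` and `q`. -/
def BlockFree (f : (ι → A) → B) (p q : ι) : Prop :=
  ∀ x y : ι → A, x p = x q → y p = y q → (∀ i, i ≠ p → i ≠ q → x i = y i) → f x = f y

/-- Every identification of two arguments makes a further argument inessential. -/
def LosesTwo (f : (ι → A) → B) : Prop :=
  ∀ p q, p ≠ q → BlockFree f p q ∨ ∃ m, m ≠ p ∧ m ≠ q ∧ FreeOn f p q m

/-- All arguments in `M` are essential in a restriction of `f` which fixes the other arguments. -/
def Rich (f : (ι → A) → B) (M : Set ι) : Prop :=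
  ∃ c : ι → A, ∀ i ∈ M, ∃ x y : ι → A,
    (∀ j, j ∉ M → x j = c j) ∧ (∀ j, j ≠ i → x j = y j) ∧ f x ≠ f y

/-- `f` is invariant under transpositions at the points with a repeated coordinate. -/
def SymmOnRepeats (f : (ι → A) → B) [DecidableEq ι] : Prop :=
  ∀ x : ι → A, ¬ Injective x → ∀ p q, f (x ∘ Equiv.swap p q) = f x

variable {f : (ι → A) → B}

theorem FreeOn.symm {p q m : ι} (h : FreeOn f p q m) : FreeOn f q p m :=
  fun x y hx hy hxy => h x y hx.symm hy.symm hxy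

theorem BlockFree.symm {p q : ι} (h : BlockFree f p q) : BlockFree f q p :=
  fun x y hx hy hxy => h x y hx.symm hy.symm fun i hp hq => hxy i hq hp

theorem exists_ne_of_not_misses {m : ι} (h : ¬ Misses f m) :
    ∃ x y : ι → A, (∀ i, i ≠ m → x i = y i) ∧ f x ≠ f y := by
  simpa [Misses] using h

/-- The arguments, other than `p` and `q`, on which `f` does not depend when `x p = x q`. -/
def freeSet (f : (ι → A) → B) (p q : ι) : Set ι := {m | m ≠ p ∧ m ≠ q ∧ FreeOn f p q m}

theorem freeSet_comm (p q : ι) : freeSet f p q = freeSet f q p := by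
  ext m
  exact ⟨fun h => ⟨h.2.1, h.1, h.2.2.symm⟩, fun h => ⟨h.2.1, h.1, h.2.2.symm⟩⟩

theorem rich_singleton {i : ι} (h : ¬ Misses f i) : Rich f {i} := by
  obtain ⟨x, y, hxy, hne⟩ := exists_ne_of_not_misses h
  refine ⟨x, ?_⟩
  rintro j rfl
  exact ⟨x, y, fun _ _ => rfl, hxy, hne⟩

theorem rich_univ [Nonempty A] (h : ∀ i, ¬ Misses f i) : Rich f Set.univ := by
  refine ⟨fun _ => Classical.arbitrary A, fun i _ => ?_⟩
  obtain ⟨x, y, hxy, hne⟩ := exists_ne_of_not_misses (h i)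
  exact ⟨x, y, fun j hj => (hj trivial).elim, hxy, hne⟩

theorem not_injective_of_eq {x : ι → A} {i j : ι} (hij : i ≠ j) (h : x i = x j) :
    ¬ Injective x := fun hx => hij (hx h)

variable [DecidableEq ι]

/-- If `f` agrees at the points with a repeated coordinate with a function that misses two
arguments, then every set of arguments is rich. -/
theorem rich_of_eq_on_repeats {h : (ι → A) → B} {l l' : ι} (hll : l ≠ l')
    (three : ∀ i j : ι, ∃ s, s ≠ i ∧ s ≠ j) (hf : ¬ Misses f l)
    (hl : Misses h l) (hl' : Misses h l') (heq : ∀ x, ¬ Injective x → f x = h x) (M : Set ι) :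
    Rich f M := by
  obtain ⟨a, ha⟩ : ∃ a, f a ≠ h a := by
    by_contra! hfh
    exact hf (by rwa [show f = h from funext hfh])
  have eq_of : ∀ (x : ι → A) (i j : ι), i ≠ j → x i = x j → f x = h x :=
    fun x i j hij hx => heq x (not_injective_of_eq hij hx)
  -- With `h` blind to some `t ∈ M`, the constants of `a` work: an inessential `i` would link `f a`
  -- to `h a` through repeat points.
  have key : ∀ t, t ∈ M → Misses h t → Rich f M := by
    intro t htM ht
    refine ⟨a, fun i hi => ?_⟩
    by_contra! hcon
    by_cases hit : i = t
    · subst hit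
      obtain ⟨s, hs, -⟩ := three i i
      have h1 := hcon a (update a i (a s)) (by grind) (by grind)
      have h2 := eq_of (update a i (a s)) i s (by grind) (by grind)
      have h3 := ht a (update a i (a s)) (by grind)
      exact ha (by rw [h1, h2, h3])
    · obtain ⟨j, hji, hjt⟩ := three i t
      have h1 := hcon (update a t (a j)) (update (update a t (a j)) i (a j)) (by grind) (by grind)
      have h2 := eq_of (update a t (a j)) t j (by grind) (by grind)
      have h3 := ht a (update a t (a j)) (by grind)
      have h4 := eq_of (update (update a t (a j)) i (a j)) t j (by grind) (by grind)
      have h5 := ht (update a i (a j)) (update (update a t (a j)) i (a j)) (by grind)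
      have h6 := eq_of (update a i (a j)) i j (by grind) (by grind)
      have h7 := hcon a (update a i (a j)) (by grind) (by grind)
      exact ha (by rw [h7, h6, h5, ← h4, ← h1, h2, h3])
  by_cases hlM : l ∈ M
  · exact key l hlM hl
  by_cases hlM' : l' ∈ M
  · exact key l' hlM' hl'
  by_contra hR
  -- Two choices of constants compete: those of `a`, and those with `l` reset to `a l'`, where every
  -- point is a repeat and `f` acts as `h`. If both fail, `f a = h a`.
  obtain ⟨i, hi, hci⟩ : ∃ i ∈ M, ∀ x y : ι → A, (∀ j, j ∉ M → x j = a j) →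
      (∀ j, j ≠ i → x j = y j) → f x = f y := by
    by_contra! hcon
    exact hR ⟨a, hcon⟩
  obtain ⟨i', hi', hci'⟩ : ∃ i ∈ M, ∀ x y : ι → A,
      (∀ j, j ∉ M → x j = update a l (a l') j) → (∀ j, j ≠ i → x j = y j) → f x = f y := by
    by_contra! hcon
    exact hR ⟨_, hcon⟩
  have hh : ∀ x y : ι → A, (∀ j, j ∉ M → x j = a j) → (∀ j, j ≠ i' → x j = y j) →
      h x = h y := by
    intro x y hx hxy
    have h1 := hl x (update x l (a l')) (by grind)
    have h2 := hl y (update y l (a l')) (by grind)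
    have h3 := hci' (update x l (a l')) (update y l (a l')) (by grind) (by grind)
    have h4 := eq_of (update x l (a l')) l l' hll (by grind)
    have h5 := eq_of (update y l (a l')) l l' hll (by grind)
    rw [h1, h2, ← h4, ← h5, h3]
  have hil : i ≠ l := by grind
  have hil' : i' ≠ l := by grind
  have h1 := hci a (update a i (a l)) (by grind) (by grind)
  have h2 := eq_of (update a i (a l)) i l hil (by grind)
  have h3 := hh (update a i (a l)) (update (update a i (a l)) i' (a l)) (by grind) (by grind)
  have h4 := eq_of (update (update a i (a l)) i' (a l)) i l hil (by grind)
  have h5 := hci (update a i' (a l)) (update (update a i (a l)) i' (a l)) (by grind)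
  have h6 := eq_of (update a i' (a l)) i' l hil' (by grind)
  have h7 := hh a (update a i' (a l)) (by grind) (by grind)
  by_cases hii : i = i'
  · subst hii
    exact ha (by rw [h1, h2, ← h7])
  · exact ha (by rw [h1, h2, h3, ← h4, ← h5 (by grind), h6, ← h7])

/-- If `f` is symmetric and not constant along some line at the points with a repeated
coordinate, then every non-empty set of arguments is rich. -/
theorem rich_of_symmOnRepeats (hs : SymmOnRepeats f) {l : ι} {a b : ι → A}
    (ha : ¬ Injective a) (hb : ¬ Injective b) (hab : ∀ i, i ≠ l → a i = b i) (hne : f a ≠ f b)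
    {M : Set ι} (hM : M.Nonempty) : Rich f M := by
  obtain ⟨t, ht⟩ := hM
  have not_inj : ∀ {x : ι → A} (p q : ι), ¬ Injective x → ¬ Injective (x ∘ Equiv.swap p q) :=
    fun p q hx hc => hx ((Equiv.injective_comp _ _).1 hc)
  -- The line is turned to the direction `t ∈ M`; swapping `t` with `i` then stays inside M and
  -- spares the constants.
  refine ⟨a ∘ Equiv.swap l t, fun i hi => ⟨(a ∘ Equiv.swap l t) ∘ Equiv.swap t i,
    (b ∘ Equiv.swap l t) ∘ Equiv.swap t i, ?_, ?_, ?_⟩⟩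
  · intro j hj
    have h1 : Equiv.swap t i j = j := Equiv.swap_apply_of_ne_of_ne (by grind) (by grind)
    simp [h1]
  · intro j hj
    refine hab _ fun hc => hj ?_
    rw [Equiv.swap_apply_eq_iff, Equiv.swap_apply_left, Equiv.swap_apply_eq_iff,
      Equiv.swap_apply_left] at hc
    exact hc
  · rwa [hs _ (not_inj l t ha), hs _ (not_inj l t hb), hs _ ha, hs _ hb]

theorem symmOnRepeats_of_blockFree (h : ∀ p q, p ≠ q → BlockFree f p q) : SymmOnRepeats f := by
  have one : ∀ (x : ι → A) (i j q : ι), i ≠ j → x i = x j → q ≠ i → q ≠ j →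
      f (x ∘ Equiv.swap i q) = f x := by
    intro x i j q hij hx hqi hqj
    -- Move the pair `i`, `j` to the value `x q`, then the new pair `q`, `j` to the old `x i`.
    have h1 := h i j hij x (update (update x i (x q)) j (x q)) hx (by grind) (by grind)
    have h2 := h q j hqj (update (update x i (x q)) j (x q)) (update (x) i (x q) |>
      fun y => update (update y q (x i)) j (x i)) (by grind) (by grind) (by grind)
    rw [h1, h2]
    congr 1
    funext s
    simp only [comp_apply, Equiv.swap_apply_def]
    grind
  intro x hx p q
  obtain ⟨i, j, hxij, hij⟩ : ∃ i j, x i = x j ∧ i ≠ j := by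
    simpa [Injective] using hx
  by_cases hpq : p = q
  · subst hpq
    simp
  have swap_ij : ∀ i j : ι, x i = x j → x ∘ Equiv.swap i j = x := by
    intro i j hxij
    funext s
    simp only [comp_apply, Equiv.swap_apply_def]
    grind
  by_cases hxpq : x p = x q
  · rw [swap_ij p q hxpq]
  by_cases hpi : p = i
  · subst hpi
    exact one x p j q hij hxij (by grind) (by grind)
  by_cases hpj : p = j
  · subst hpj
    exact one x p i q hij.symm hxij.symm (by grind) (by grind)
  by_cases hqi : q = i
  · subst hqi
    rw [Equiv.swap_comm]
    exact one x q j p hij hxij (by grind) (by grind)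
  by_cases hqj : q = j
  · subst hqj
    rw [Equiv.swap_comm]
    exact one x q i p hij.symm hxij.symm (by grind) (by grind)
  -- (p q) = (i p)(p q)(q i), each factor moving a member of the current repeated pair.
  have e1 := one x i j p hij hxij (by grind) (by grind)
  have e2 := one (x ∘ Equiv.swap i p) p j q (by grind)
    (by simp only [comp_apply, Equiv.swap_apply_def]; grind) (by grind) (by grind)
  have e3 := one ((x ∘ Equiv.swap i p) ∘ Equiv.swap p q) q j i (by grind)
    (by simp only [comp_apply, Equiv.swap_apply_def]; grind) (by grind) (by grind)
  rw [← e1, ← e2, ← e3]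
  congr 1
  funext s
  simp only [comp_apply, Equiv.swap_apply_def]
  grind

end Hyperplanes

end ArityGap

namespace ArityGap

open Function

/-! ### Replacing one argument at repeat points. -/

section Stars

variable {ι A B : Type*} {f : (ι → A) → B} [DecidableEq ι]

/-- On the hyperplane `x p = x j` the common value may be replaced by `x q` in position `p`. -/
def RayConstant (f : (ι → A) → B) (p q j : ι) : Prop :=
  ∀ x : ι → A, x p = x j → f x = f (update x p (x q))

/-- At the points where `x p` is the value of another argument, `f` does not depend on which. -/
def StarConstant (f : (ι → A) → B) (p q : ι) : Prop :=
  ∀ j, j ≠ p → RayConstant f p q j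

/-- Moving `p` and `m` together to `x q` lands on `x p = x q`, where `m` can be put back. -/
theorem FreeOn.rayConstant {p q m : ι} (hm : FreeOn f p q m) (hpq : p ≠ q) (hmp : m ≠ p)
    (hmq : m ≠ q) (hB : BlockFree f p m) : RayConstant f p q m := by
  intro x hx
  rw [hB x (update (update x p (x q)) m (x q)) hx (by grind) (by grind)]
  exact hm _ _ (by grind) (by grind) (by grind)

/-- If `l` is free on `x p = x q`, it may be used to move to the hyperplane `x p = x j`. -/
theorem FreeOn.move {p q l j : ι} (hl : FreeOn f p q l) (hstar : RayConstant f p q l)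
    (hpq : p ≠ q) (hlp : l ≠ p) (hlq : l ≠ q) {z : ι → A} (hz : z p = z q) :
    f z = f (update (update z l (z j)) p (z j)) := by
  have h1 := hl z (update z l (z j)) hz (by grind) (by grind)
  have h2 := hstar (update (update z l (z j)) p (z j)) (by grind)
  have h3 : update (update (update z l (z j)) p (z j)) p
      (update (update z l (z j)) p (z j) q) = update z l (z j) := by grind
  rw [h1, h2, h3]

/-- Set `l` and `m` to the new value, carry `p` there along the ray read backwards, change `q`,
which is free once `p` and `m` agree, and restore `l`, `m`. -/
theorem FreeOn.blockFree_of_freeOn {p q l m : ι} (hpq : p ≠ q) (hlp : l ≠ p) (hlq : l ≠ q)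
    (hmp : m ≠ p) (hmq : m ≠ q) (hml : m ≠ l)
    (hl : FreeOn f p q l) (hstar : RayConstant f p q l)
    (hm : FreeOn f p q m) (hq : FreeOn f p m q) : BlockFree f p q := by
  intro x y hx hy hxy
  have h1 := hm x (update x m (y p)) hx (by grind) (by grind)
  have h2 := hl (update x m (y p)) (update (update x m (y p)) l (y p)) (by grind) (by grind)
    (by grind)
  have h3 := hstar (update (update (update x m (y p)) l (y p)) p (y p)) (by grind)
  have h4 : update (update (update (update x m (y p)) l (y p)) p (y p)) p
      (update (update (update x m (y p)) l (y p)) p (y p) q) =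
      update (update x m (y p)) l (y p) := by grind
  have h5 := hq (update (update (update x m (y p)) l (y p)) p (y p))
    (update (update y m (y p)) l (y p)) (by grind) (by grind) (by grind)
  have h6 := hl (update y m (y p)) (update (update y m (y p)) l (y p)) (by grind) (by grind)
    (by grind)
  have h7 := hm y (update y m (y p)) hy (by grind) (by grind)
  rw [h1, h2, ← h4, ← h3, h5, ← h6, ← h7]

/-- Through `l`, `p` takes the value of `j`; the pair `p`, `j` then returns to `x q`. So `j` can be
normalised to `x q`. -/
theorem FreeOn.freeOn_of_blockFree {p q l j : ι} (hpq : p ≠ q) (hlp : l ≠ p) (hlq : l ≠ q)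
    (hjp : j ≠ p) (hjq : j ≠ q) (hjl : j ≠ l)
    (hl : FreeOn f p q l) (hstar : RayConstant f p q l) (hBj : BlockFree f p j) :
    FreeOn f p q j := by
  have to_q : ∀ z : ι → A, z p = z q → f z = f (update z j (z q)) := by
    intro z hz
    have h1 := hl z (update z l (z j)) hz (by grind) (by grind)
    have h2 := hl (update z j (z q)) (update (update z l (z j)) j (z q)) (by grind) (by grind)
      (by grind)
    have h3 := hstar (update (update z l (z j)) p (z j)) (by grind)
    have h4 : update (update (update z l (z j)) p (z j)) p
      (update (update z l (z j)) p (z j) q) = update z l (z j) := by grind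
    have h5 := hBj (update (update z l (z j)) p (z j)) (update (update z l (z j)) j (z q))
      (by grind) (by grind) (by grind)
    rw [h1, h2, ← h5, h3, h4]
  intro z w hz hw hzw
  rw [to_q z hz, to_q w hw]
  clear to_q
  congr 1
  funext i
  have := hzw i
  have := hzw q
  grind

/-- If `j ≠ q` is not free, `x p = x j` still loses some argument `m`. Transferred to `x p = x q`,
this is contradictory unless `m` is already free there, and then the ray at `m` serves for `j`. -/
theorem starConstant_of_blockFree (hf : LosesTwo f) {p q l : ι} (hpq : p ≠ q)
    (hB : ¬ BlockFree f p q) (hlp : l ≠ p) (hlq : l ≠ q) (hl : FreeOn f p q l)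
    (hBl : BlockFree f p l)
    (hmin : ∀ m, m ≠ p → m ≠ q → FreeOn f p q m → BlockFree f p m ∨ FreeOn f p m q) :
    StarConstant f p q := by
  have hstar := hl.rayConstant hpq hlp hlq hBl
  have star_of_free : ∀ m, m ≠ p → m ≠ q → FreeOn f p q m → RayConstant f p q m := by
    intro m hmp hmq hm
    by_cases hml : m = l
    · exact hml ▸ hstar
    exact hm.rayConstant hpq hmp hmq ((hmin m hmp hmq hm).resolve_right fun hq =>
      hB (hl.blockFree_of_freeOn hpq hlp hlq hmp hmq hml hstar hm hq))
  clear hmin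
  intro j hjp
  by_cases hjq : j = q
  · subst hjq
    intro x hx
    rw [← hx, update_eq_self]
  by_cases hjD : FreeOn f p q j
  · exact star_of_free j hjp hjq hjD
  intro x hx
  have hjl : j ≠ l := by rintro rfl; exact hjD hl
  rcases hf p j hjp.symm with hBj | ⟨m, hmp, hmj, hm⟩
  · exact (hjD (hl.freeOn_of_blockFree hpq hlp hlq hjp hjq hjl hstar hBj)).elim
  · by_cases hmq : m = q
    · subst hmq
      refine (hB fun z w hz hw hzw => ?_).elim
      rw [hl.move (j := j) hstar hpq hlp hlq hz, hl.move (j := j) hstar hpq hlp hlq hw]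
      clear star_of_free
      exact hm _ _ (by grind) (by grind) (by grind)
    by_cases hmD : FreeOn f p q m
    · have h2 := star_of_free m hmp hmq hmD (update x m (x p)) (by grind)
      clear star_of_free
      have h1 := hm x (update x m (x p)) hx (by grind) (by grind)
      have h3 := hmD (update x p (x q)) (update (update x m (x p)) p (update x m (x p) q))
        (by grind) (by grind) (by grind)
      rw [h1, h2, h3]
    · refine (hmD fun z w hz hw hzw => ?_).elim
      have hml : m ≠ l := by rintro rfl; exact hmD hl
      rw [hl.move (j := j) hstar hpq hlp hlq hz, hl.move (j := j) hstar hpq hlp hlq hw]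
      clear star_of_free
      exact hm _ _ (by grind) (by grind) (by grind)

theorem StarConstant.eq_of_ne {p q : ι} (h : StarConstant f p q) (hpq : p ≠ q) (z : ι → A)
    {s t : ι} (hs : s ≠ p) (ht : t ≠ p) : f (update z p (z s)) = f (update z p (z t)) := by
  have h1 := h s hs (update z p (z s)) (by grind)
  have h2 := h t ht (update z p (z t)) (by grind)
  rw [h1, h2]
  congr 1
  grind

/-- Under `StarConstant`, `f` does not depend on `x p` at all points of a hyperplane `x i = x j`
unless `i`, `j`, `p` are the only arguments. -/
theorem StarConstant.eq_on_hyperplane {p q i j : ι} (h : StarConstant f p q) (hpq : p ≠ q)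
    (hip : i ≠ p) (hjp : j ≠ p) (hij : i ≠ j)
    (hf : (∃ m, m ≠ i ∧ m ≠ j ∧ FreeOn f i j m) ∨
      (BlockFree f i j ∧ ∃ s, s ≠ p ∧ s ≠ i ∧ s ≠ j))
    {x : ι → A} (hx : x i = x j) : f x = f (update x p (x q)) := by
  rcases hf with ⟨m, hmi, hmj, hm⟩ | ⟨hB, s, hsp, hsi, hsj⟩
  · by_cases hmp : m = p
    · subst hmp
      exact hm _ _ hx (by grind) (by grind)
    · have h1 := hm x (update x m (x p)) hx (by grind) (by grind)
      have h2 := h.eq_of_ne hpq (update x m (x p)) hmp hip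
      have h3 : update (update x m (x p)) p (update x m (x p) m) = update x m (x p) := by grind
      have h4 := hm (update (update x m (x p)) p (update x m (x p) i)) (update x p (x i))
        (by grind) (by grind) (by grind)
      rw [h1, ← h3, h2, h4, h.eq_of_ne hpq x hip hpq.symm]
  -- The pair is parked at `x p`, `p` is carried to `x s`, and the pair is put back; `s` avoids `i`,
  -- `j` so that `x s` survives the parking.
  · have h1 := hB x (update (update x i (x p)) j (x p)) hx (by grind) (by grind)
    have h2 := h.eq_of_ne hpq (update (update x i (x p)) j (x p)) hip hsp
    have h3 : update (update (update x i (x p)) j (x p)) p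
        (update (update x i (x p)) j (x p) i) = update (update x i (x p)) j (x p) := by grind
    have h4 := hB (update (update (update x i (x p)) j (x p)) p
      (update (update x i (x p)) j (x p) s)) (update x p (x s)) (by grind) (by grind) (by grind)
    rw [h1, ← h3, h2, h4, h.eq_of_ne hpq x hsp hpq.symm]

theorem rich_of_starConstant {p q l : ι} (h : StarConstant f p q) (hpq : p ≠ q)
    (hlp : l ≠ p) (hlq : l ≠ q) (hl : FreeOn f p q l) (hp : ¬ Misses f p)
    (hf : ∀ i j, i ≠ p → j ≠ p → i ≠ j → (∃ m, m ≠ i ∧ m ≠ j ∧ FreeOn f i j m) ∨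
      (BlockFree f i j ∧ ∃ s, s ≠ p ∧ s ≠ i ∧ s ≠ j)) (M : Set ι) : Rich f M := by
  refine rich_of_eq_on_repeats (h := fun x => f (update x p (x q))) (l := p) (l' := l) hlp.symm
    ?_ hp ?_ ?_ ?_ M
  · intro i j
    by_cases h1 : p ≠ i ∧ p ≠ j
    · exact ⟨p, h1⟩
    by_cases h2 : q ≠ i ∧ q ≠ j
    · exact ⟨q, h2⟩
    exact ⟨l, by grind⟩
  · intro x y hxy
    change f _ = f _
    clear hf
    congr 1
    grind
  · intro x y hxy
    clear hf
    exact hl _ _ (by grind) (by grind) (by grind)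
  · intro x hx
    obtain ⟨i, j, hxij, hij⟩ : ∃ i j, x i = x j ∧ i ≠ j := by
      simpa [Injective] using hx
    by_cases hip : i = p
    · subst hip
      exact h j hij.symm x hxij
    by_cases hjp : j = p
    · subst hjp
      exact h i hij x hxij.symm
    exact h.eq_on_hyperplane hpq hip hjp hij (hf i j hip hjp hij) hxij

/-- The case of three arguments where two hyperplanes give the same function of the middle
argument, and the third one gives the same function of the first argument. -/
theorem rich_of_three {p q l : ι} (hpq : p ≠ q) (hlp : l ≠ p) (hlq : l ≠ q)
    (huniv : ∀ i, i = p ∨ i = q ∨ i = l) {a b : A} {u v : B} (huv : u ≠ v)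
    (hu : ∀ x : ι → A, x p = a → x q = a → f x = u)
    (hv : ∀ x : ι → A, x p = b → x q = b → f x = v)
    (hv1 : ∀ x : ι → A, x p = x l → x q = b → f x = v)
    (hu2 : ∀ x : ι → A, x q = x l → x p = a → f x = u)
    (hv2 : ∀ x : ι → A, x q = x l → x p = b → f x = v)
    {M : Set ι} (hM : ∃ i, i ∉ M)
    (hM2 : ∀ i ∈ M, ∃ j ∈ M, j ≠ i) : Rich f M := by
  -- The frozen argument `s` gets `a` if it is `p` or `l`, and `b` if it is `q`.
  obtain ⟨s, hs⟩ := hM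
  rcases huniv s with hsp | hsq | hsl
  · refine ⟨fun _ => a, fun i hi => ?_⟩
    rcases huniv i with rfl | rfl | rfl
    · exact (hs (hsp ▸ hi)).elim
    · refine ⟨fun _ => a, update (fun _ => a) i b, fun _ _ => rfl,
        fun j hj => by simp [hj], ?_⟩
      rw [hu _ rfl rfl, hv1 _ (by simp [hpq, hlq]) (by simp)]
      exact huv
    · have hq : q ∈ M := by
        obtain ⟨j, hj, hji⟩ := hM2 i hi
        rcases huniv j with rfl | rfl | rfl
        · exact (hs (hsp ▸ hj)).elim
        · exact hj
        · exact (hji rfl).elim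
      refine ⟨update (fun _ => a) q b, update (update (fun _ => a) q b) i b,
        fun j hj => update_of_ne (by rintro rfl; exact hj hq) _ _,
        fun j hj => (update_of_ne hj _ _).symm, ?_⟩
      rw [hv1 (update _ q b) (by simp [hpq, hlq]) (by simp),
        hu2 _ (by simp [hlq.symm]) (by simp [hpq, hlp.symm])]
      exact huv.symm
  · refine ⟨fun _ => b, fun i hi => ?_⟩
    rcases huniv i with rfl | rfl | rfl
    · refine ⟨fun _ => b, update (fun _ => b) i a, fun _ _ => rfl,
        fun j hj => by simp [hj], ?_⟩
      rw [hv _ rfl rfl, hu2 _ (by simp [hpq.symm, hlp]) (by simp)]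
      exact huv.symm
    · exact (hs (hsq ▸ hi)).elim
    · have hp : p ∈ M := by
        obtain ⟨j, hj, hji⟩ := hM2 i hi
        rcases huniv j with rfl | rfl | rfl
        · exact hj
        · exact (hs (hsq ▸ hj)).elim
        · exact (hji rfl).elim
      refine ⟨update (fun _ => b) p a, update (update (fun _ => b) p a) i a,
        fun j hj => update_of_ne (by rintro rfl; exact hj hp) _ _,
        fun j hj => (update_of_ne hj _ _).symm, ?_⟩
      rw [hu2 (update _ p a) (by simp [hpq.symm, hlp]) (by simp),
        hv1 _ (by simp [hlp.symm]) (by simp [hpq.symm, hlq.symm])]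
      exact huv
  · refine ⟨fun _ => a, fun i hi => ?_⟩
    rcases huniv i with rfl | rfl | rfl
    · refine ⟨fun _ => a, update (fun _ => a) i b, fun _ _ => rfl,
        fun j hj => by simp [hj], ?_⟩
      rw [hu _ rfl rfl, hv2 _ (by simp [hpq.symm, hlp]) (by simp)]
      exact huv
    · refine ⟨fun _ => a, update (fun _ => a) i b, fun _ _ => rfl,
        fun j hj => by simp [hj], ?_⟩
      rw [hu _ rfl rfl, hv1 _ (by simp [hpq, hlq]) (by simp)]
      exact huv
    · exact (hs (hsl ▸ hi)).elim

/-- The exceptional case: on `x q = x l` the value is governed by `x p` instead of `x q`. Failure of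
`BlockFree f p q` supplies two distinct diagonal values. -/
theorem StarConstant.rich_of_blockFree {p q l : ι} (h : StarConstant f p q) (hpq : p ≠ q)
    (hlp : l ≠ p) (hlq : l ≠ q) (huniv : ∀ i, i = p ∨ i = q ∨ i = l) (hl : FreeOn f p q l)
    (hB : ¬ BlockFree f p q) (hBql : BlockFree f q l) {M : Set ι} (hM : ∃ i, i ∉ M)
    (hM2 : ∀ i ∈ M, ∃ j ∈ M, j ≠ i) : Rich f M := by
  obtain ⟨z, w, hz, hw, -, hzw⟩ : ∃ z w : ι → A, z p = z q ∧ w p = w q ∧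
      (∀ i, i ≠ p → i ≠ q → z i = w i) ∧ f z ≠ f w := by
    simpa [BlockFree] using hB
  have diag : ∀ z x : ι → A, z p = z q → x p = z p → x q = z p → f x = f z := by
    intro z x hz h1 h2
    refine hl _ _ (h1.trans h2.symm) hz fun i hi => ?_
    rcases huniv i with rfl | rfl | rfl
    · exact h1
    · exact h2.trans hz
    · exact (hi rfl).elim
  have third : ∀ z x : ι → A, z p = z q → x q = x l → x p = z p → f x = f z := by
    intro z x hz h1 h2
    rw [hBql x (fun _ => z p) h1 rfl fun i hq hl => ?_]
    · exact diag z _ hz rfl rfl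
    · rcases huniv i with rfl | rfl | rfl
      · exact h2
      · exact (hq rfl).elim
      · exact (hl rfl).elim
  refine rich_of_three hpq hlp hlq huniv hzw (diag z · hz) (diag w · hw) ?_ (third z · hz)
    (third w · hw) hM hM2
  intro x h1 h2
  rw [h l hlp x h1]
  exact diag w _ hw (by simp [h2]) (by simp [hpq.symm, h2])

end Stars

end ArityGap

namespace ArityGap

open Function

/-! ### The minimal pair and the case analysis. -/

section Main

variable {ι A B : Type*} {f : (ι → A) → B} [DecidableEq ι]

/-- With `l` at the old value and `m` at the new one, `q` moves while `p` agrees with `l`, then `p`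
moves while `q` agrees with `m`. -/
theorem blockFree_of_two_free {p q l m : ι} (hpq : p ≠ q) (hlp : l ≠ p) (hlq : l ≠ q)
    (hmp : m ≠ p) (hmq : m ≠ q) (hml : m ≠ l) (hl : FreeOn f p q l) (hm : FreeOn f p q m)
    (h1 : FreeOn f p l q) (h2 : FreeOn f q m p) : BlockFree f p q := by
  intro x y hx hy hxy
  have e1 := hl x (update x l (x p)) hx (by grind) (by grind)
  have e2 := hm (update x l (x p)) (update (update x l (x p)) m (y p)) (by grind) (by grind)
    (by grind)
  have e3 := h1 (update (update x l (x p)) m (y p)) (update (update (update x l (x p)) m (y p)) q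
    (y p)) (by grind) (by grind) (by grind)
  have e4 := h2 (update (update (update x l (x p)) m (y p)) q (y p))
    (update (update y l (x p)) m (y p)) (by grind) (by grind) (by grind)
  have e5 := hm (update y l (x p)) (update (update y l (x p)) m (y p)) (by grind) (by grind)
    (by grind)
  have e6 := hl y (update y l (x p)) hy (by grind) (by grind)
  rw [e1, e2, e3, e4, ← e5, ← e6]

theorem blockFree_of_move {p q r : ι} (hrp : r ≠ p) (hrq : r ≠ q)
    (h : ∀ x : ι → A, x p = x q → f x = f (update (update x p (x r)) q (x r))) :
    BlockFree f p q := by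
  intro x y hx hy hxy
  rw [h x hx, h y hy]
  clear h
  congr 1
  have := hxy r
  grind

/-- Setting `l` to `x p` lets `p` move to `x r`; whatever `x p = x r` loses is pulled back to `x p =
x q`. -/
theorem blockFree_or_freeOn {p q l r : ι} (hf : LosesTwo f) (hpq : p ≠ q) (hlp : l ≠ p)
    (hlq : l ≠ q) (hrp : r ≠ p) (hrq : r ≠ q) (hrl : r ≠ l) (hl : FreeOn f p q l)
    (h1 : FreeOn f p l q) (h2 : FreeOn f q l p) :
    BlockFree f p q ∨ ∃ m, m ≠ p ∧ m ≠ q ∧ m ≠ l ∧ FreeOn f p q m := by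
  have move : ∀ x : ι → A, x p = x q → f x = f (update (update x l (x p)) p (x r)) := by
    intro x hx
    have e1 := hl x (update x l (x p)) hx (by grind) (by grind)
    have e2 := h2 (update x l (x p)) (update (update x l (x p)) p (x r)) (by grind) (by grind)
      (by grind)
    rw [e1, e2]
  rcases hf p r hrp.symm with hB | ⟨m, hmp, hmr, hm⟩
  · refine Or.inr ⟨r, hrp, hrq, hrl, fun x y hx hy hxy => ?_⟩
    rw [move x hx, move y hy]
    clear move
    exact hB _ _ (by grind) (by grind) (by grind)
  by_cases hmq : m = q
  · subst hmq
    refine Or.inl (blockFree_of_move hrp hrq fun x hx => ?_)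
    rw [move x hx]
    clear move
    have e1 := hm (update (update x l (x p)) p (x r))
      (update (update (update x l (x p)) p (x r)) m (x r)) (by grind) (by grind) (by grind)
    rw [e1]
    exact hl _ _ (by grind) (by grind) (by grind)
  by_cases hml : m = l
  · subst hml
    refine Or.inl (blockFree_of_move hrp hrq fun x hx => ?_)
    rw [move x hx]
    clear move
    have e1 := hm (update (update x m (x p)) p (x r))
      (update (update x m (x r)) p (x r)) (by grind) (by grind) (by grind)
    have e2 := h1 (update (update x m (x r)) p (x r))
      (update (update (update x m (x r)) p (x r)) q (x r)) (by grind) (by grind) (by grind)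
    rw [e1, e2]
    exact hl _ _ (by grind) (by grind) (by grind)
  refine Or.inr ⟨m, hmp, hmq, hml, fun x y hx hy hxy => ?_⟩
  rw [move x hx, move y hy]
  clear move
  have := hxy r
  exact hm _ _ (by grind) (by grind) (by grind)

/-- Setting `l` to `x p` sends `x p = x q` into `x p = x l`, so free arguments pull back, and `l` is
gained. -/
theorem freeSet_ssubset {p q l : ι} (hpq : p ≠ q) (hl : l ∈ freeSet f p q)
    (hq : ¬ FreeOn f p l q) : freeSet f p l ⊂ freeSet f p q := by
  obtain ⟨hlp, hlq, hl'⟩ := hl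
  refine (Set.ssubset_iff_of_subset ?_).2 ⟨l, ⟨hlp, hlq, hl'⟩, fun h => h.2.1 rfl⟩
  rintro m ⟨hmp, hml, hm⟩
  have hmq : m ≠ q := by rintro rfl; exact hq hm
  refine ⟨hmp, hmq, fun x y hx hy hxy => ?_⟩
  have e1 := hl' x (update x l (x p)) hx (by grind) (by grind)
  have e2 := hl' y (update y l (x p)) hy (by grind) (by grind)
  rw [e1, e2]
  exact hm _ _ (by grind) (by grind) (by grind)

theorem blockFree_or_freeOn_of_minimal [Finite ι] {p q l : ι} (hpq : p ≠ q)
    (hl : l ∈ freeSet f p q)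
    (hmin : ∀ m, m ≠ p → ¬ BlockFree f p m → (freeSet f p q).ncard ≤ (freeSet f p m).ncard) :
    BlockFree f p l ∨ FreeOn f p l q := by
  by_contra! h
  exact (Set.ncard_lt_ncard (freeSet_ssubset hpq hl h.2)).not_ge (hmin l hl.1 h.1)

/-- If no line joins repeat points with different values, resetting `p` to `x q` is harmless there
and yields a function missing `p` and `l`. -/
theorem rich_of_symm (three : ∀ i j : ι, ∃ s, s ≠ i ∧ s ≠ j) (hf : ∀ i, ¬ Misses f i)
    (hs : SymmOnRepeats f) {M : Set ι} (hM : M.Nonempty) : Rich f M := by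
  by_cases hc : ∃ (l : ι) (a b : ι → A), ¬ Injective a ∧ ¬ Injective b ∧
      (∀ i, i ≠ l → a i = b i) ∧ f a ≠ f b
  · obtain ⟨l, a, b, ha, hb, hab, hne⟩ := hc
    exact rich_of_symmOnRepeats hs ha hb hab hne hM
  push Not at hc
  obtain ⟨p, -⟩ := hM
  obtain ⟨q, hqp, -⟩ := three p p
  obtain ⟨l, hlp, hlq⟩ := three p q
  refine rich_of_eq_on_repeats (h := fun x => f (update x p (x q))) (l := p) (l' := l) hlp.symm
    three (hf p) ?_ ?_ ?_ M
  · intro x y hxy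
    change f _ = f _
    congr 1
    clear hc three
    grind
  · intro x y hxy
    refine hc l _ _ (not_injective_of_eq hqp (by simp [hqp]))
      (not_injective_of_eq hqp (by simp [hqp])) ?_
    clear hc three
    grind
  · intro x hx
    exact hc p _ _ hx (not_injective_of_eq hqp (by simp [hqp]))
      fun i hi => (update_of_ne hi _ _).symm

theorem rich_of_free_of_blockFree (hf : LosesTwo f) (hess : ∀ i, ¬ Misses f i) {p q l : ι}
    (hpq : p ≠ q) (hB : ¬ BlockFree f p q) (hl : l ∈ freeSet f p q) (hBl : BlockFree f p l)
    (hmin : ∀ m ∈ freeSet f p q, BlockFree f p m ∨ FreeOn f p m q)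
    {M : Set ι} (hM : ∃ i, i ∉ M) (hM2 : ∀ i ∈ M, ∃ j ∈ M, j ≠ i) : Rich f M := by
  obtain ⟨hlp, hlq, hl⟩ := hl
  have hstar := starConstant_of_blockFree hf hpq hB hlp hlq hl hBl
    fun m hmp hmq hm => hmin m ⟨hmp, hmq, hm⟩
  by_cases hex : (∀ i, i = p ∨ i = q ∨ i = l) ∧ BlockFree f q l
  · exact hstar.rich_of_blockFree hpq hlp hlq hex.1 hl hB hex.2 hM hM2
  refine rich_of_starConstant hstar hpq hlp hlq hl (hess p) (fun i j hip hjp hij => ?_) M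
  rcases hf i j hij with hBij | h
  · refine Or.inr ⟨hBij, ?_⟩
    by_contra! hcon
    have cover : ∀ s, s = p ∨ s = i ∨ s = j := by
      intro s
      by_contra! hs
      exact hs.2.2 (hcon s hs.1 hs.2.1)
    have hq := (cover q).resolve_left hpq.symm
    have hl' := (cover l).resolve_left hlp
    refine hex ⟨fun s => ?_, ?_⟩
    · have hs := cover s
      clear cover hcon hex hstar hmin hM2 hess
      grind
    · rcases hq with rfl | rfl <;> rcases hl' with rfl | rfl
      · exact (hlq rfl).elim
      · exact hBij
      · exact hBij.symm
      · exact (hlq rfl).elim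
  · exact Or.inl h

/-- At a repeat point the third argument is free, so only the repeated value counts. -/
theorem symmOnRepeats_of_majority {p q l : ι} (huniv : ∀ i, i = p ∨ i = q ∨ i = l)
    (h1 : FreeOn f p q l) (h2 : FreeOn f p l q) (h3 : FreeOn f q l p) : SymmOnRepeats f := by
  have maj : ∀ (x : ι → A) (i j : ι), i ≠ j → x i = x j → f x = f fun _ => x i := by
    intro x i j hij hx
    have e1 : x p = x q → f x = f fun _ => x p := fun h => h1 _ _ h rfl fun s hs => by
      rcases huniv s with rfl | rfl | rfl
      · rfl
      · exact h.symm
      · exact (hs rfl).elim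
    have e2 : x p = x l → f x = f fun _ => x p := fun h => h2 _ _ h rfl fun s hs => by
      rcases huniv s with rfl | rfl | rfl
      · rfl
      · exact (hs rfl).elim
      · exact h.symm
    have e3 : x q = x l → f x = f fun _ => x q := fun h => h3 _ _ h rfl fun s hs => by
      rcases huniv s with rfl | rfl | rfl
      · exact (hs rfl).elim
      · rfl
      · exact h.symm
    rcases huniv i with rfl | rfl | rfl <;> rcases huniv j with rfl | rfl | rfl
    · exact (hij rfl).elim
    · exact e1 hx
    · exact e2 hx
    · rw [hx]; exact e1 hx.symm
    · exact (hij rfl).elim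
    · exact e3 hx
    · rw [hx]; exact e2 hx.symm
    · rw [hx]; exact e3 hx.symm
    · exact (hij rfl).elim
  intro x hx s t
  obtain ⟨i, j, hxij, hij⟩ : ∃ i j, x i = x j ∧ i ≠ j := by
    simpa [Injective] using hx
  rw [maj x i j hij hxij, maj (x ∘ Equiv.swap s t) (Equiv.swap s t i) (Equiv.swap s t j)
    (by simpa using hij) (by simpa using hxij)]
  simp

/-- If every argument of `f` is essential and every identification of two arguments makes a
further argument inessential, then every non-empty set of arguments is rich. -/
theorem LosesTwo.rich [Finite ι] (hf : LosesTwo f) (hess : ∀ i, ¬ Misses f i)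
    {M : Set ι} (hM : M.Nonempty) : Rich f M := by
  by_cases hMu : M = Set.univ
  · obtain ⟨i, hi⟩ := hM
    obtain ⟨x, -, -⟩ := exists_ne_of_not_misses (hess i)
    have : Nonempty A := ⟨x i⟩
    exact hMu ▸ rich_univ hess
  by_cases hMs : ∃ i, M = {i}
  · obtain ⟨i, rfl⟩ := hMs
    exact rich_singleton (hess i)
  have hM1 : ∃ i, i ∉ M := (Set.ne_univ_iff_exists_notMem M).1 hMu
  have hM2 : ∀ i ∈ M, ∃ j ∈ M, j ≠ i := by
    intro i hi
    by_contra! hcon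
    exact hMs ⟨i, Set.eq_singleton_iff_unique_mem.2 ⟨hi, hcon⟩⟩
  have three : ∀ i j : ι, ∃ s, s ≠ i ∧ s ≠ j := by
    intro i j
    by_contra! hcon
    obtain ⟨c, hc⟩ := hM1
    obtain ⟨a, ha⟩ := hM
    obtain ⟨b, hb, hba⟩ := hM2 a ha
    have cover : ∀ s, s = i ∨ s = j := by
      intro s
      by_contra! hs
      exact hs.2 (hcon s hs.1)
    have hac : a ≠ c := by rintro rfl; exact hc ha
    have hbc : b ≠ c := by rintro rfl; exact hc hb
    rcases cover a with rfl | rfl <;> rcases cover b with rfl | rfl <;>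
      rcases cover c with rfl | rfl <;> contradiction
  by_cases hall : ∀ p q, p ≠ q → BlockFree f p q
  · exact rich_of_symm three hess (symmOnRepeats_of_blockFree hall) hM
  push Not at hall
  obtain ⟨p₀, q₀, hpq₀, hB₀⟩ := hall
  -- `freeSet` and `BlockFree` are symmetric in the pair, so minimality can be used from both ends.
  obtain ⟨⟨p, q⟩, ⟨hpq, hB⟩, hmin⟩ := Set.exists_min_image
    {e : ι × ι | e.1 ≠ e.2 ∧ ¬ BlockFree f e.1 e.2} (fun e => (freeSet f e.1 e.2).ncard)
    (Set.toFinite _) ⟨(p₀, q₀), hpq₀, hB₀⟩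
  change p ≠ q at hpq
  change ¬ BlockFree f p q at hB
  have hp : ∀ m ∈ freeSet f p q, BlockFree f p m ∨ FreeOn f p m q := fun m hm =>
    blockFree_or_freeOn_of_minimal hpq hm fun s hs hBs => hmin (p, s) ⟨hs.symm, hBs⟩
  have hq : ∀ m ∈ freeSet f q p, BlockFree f q m ∨ FreeOn f q m p := fun m hm =>
    blockFree_or_freeOn_of_minimal hpq.symm hm fun s hs hBs => by
      rw [freeSet_comm]
      exact hmin (q, s) ⟨hs.symm, hBs⟩
  obtain ⟨l, hl⟩ : (freeSet f p q).Nonempty := by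
    rcases hf p q hpq with h | h
    · exact (hB h).elim
    · exact h
  by_cases hα : ∃ m ∈ freeSet f p q, BlockFree f p m
  · obtain ⟨m, hm, hBm⟩ := hα
    exact rich_of_free_of_blockFree hf hess hpq hB hm hBm hp hM1 hM2
  by_cases hα' : ∃ m ∈ freeSet f q p, BlockFree f q m
  · obtain ⟨m, hm, hBm⟩ := hα'
    exact rich_of_free_of_blockFree hf hess hpq.symm (fun h => hB h.symm) hm hBm hq hM1 hM2
  push Not at hα hα'
  have hp' : ∀ m ∈ freeSet f p q, FreeOn f p m q := fun m hm => (hp m hm).resolve_left (hα m hm)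
  have hq' : ∀ m ∈ freeSet f p q, FreeOn f q m p := fun m hm => by
    rw [freeSet_comm] at hm
    exact (hq m hm).resolve_left (hα' m hm)
  by_cases huniv : ∀ i, i = p ∨ i = q ∨ i = l
  · exact rich_of_symm three hess
      (symmOnRepeats_of_majority huniv hl.2.2 (hp' l hl) (hq' l hl)) hM
  push Not at huniv
  obtain ⟨r, hrp, hrq, hrl⟩ := huniv
  rcases blockFree_or_freeOn hf hpq hl.1 hl.2.1 hrp hrq hrl hl.2.2 (hp' l hl) (hq' l hl) with
    h | ⟨m, hmp, hmq, hml, hm⟩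
  · exact (hB h).elim
  · exact (hB (blockFree_of_two_free hpq hl.1 hl.2.1 hmp hmq hml hl.2.2 hm (hp' l hl)
      (hq' m ⟨hmp, hmq, hm⟩))).elim

end Main

end ArityGap

namespace KValued

open Function ArityGap

/-! ### From the arity gap to hyperplanes, and from richness to subfunctions. -/

section Transfer

variable {k n : ℕ} {f : Op k n}

theorem eq_update_of_notMem_Ess {i : Fin n} (hi : i ∉ Ess f) (a : Fin n → Fin k) (b : Fin k) :
    f a = f (update a i b) := by
  by_contra h
  exact hi (by simpa [Ess] using ⟨a, b, h⟩)

theorem exists_of_mem_Ess {i : Fin n} (hi : i ∈ Ess f) :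
    ∃ (a : Fin n → Fin k) (b : Fin k), f a ≠ f (update a i b) := by
  classical
  exact (Finset.mem_filter.1 hi).2

theorem mem_Ess_of_ne {i : Fin n} {x y : Fin n → Fin k} (h : ∀ j, j ≠ i → x j = y j)
    (hne : f x ≠ f y) : i ∈ Ess f := by
  have : y = update x i (y i) := by grind
  rw [this] at hne
  simpa [Ess] using ⟨x, y i, hne⟩

/-- A function is determined by the values of its essential variables. -/
theorem eq_of_eqOn_Ess {x y : Fin n → Fin k} (h : ∀ i ∈ Ess f, x i = y i) : f x = f y := by
  have key : ∀ S : Finset (Fin n), Disjoint S (Ess f) → f (S.piecewise y x) = f x := by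
    intro S
    induction S using Finset.induction_on with
    | empty => simp
    | insert j S _ ih =>
      intro hd
      rw [Finset.disjoint_insert_left] at hd
      rw [Finset.piecewise_insert, ← eq_update_of_notMem_Ess hd.1, ih hd.2]
  rw [← key (Ess f)ᶜ disjoint_compl_left]
  congr 1
  funext i
  by_cases hi : i ∈ Ess f
  · simp [hi, h i hi]
  · simp [hi]

theorem subfunction_piecewise (c : Fin n → Fin k) (S : Finset (Fin n)) :
    Subfunction f (fun a => f (S.piecewise c a)) := by
  induction S using Finset.induction_on with
  | empty =>
    simp only [Finset.piecewise_empty]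
    exact Relation.ReflTransGen.refl
  | insert j S hj ih =>
    have e : (fun a => f ((insert j S).piecewise c a)) =
        assign (fun a => f (S.piecewise c a)) j (c j) := by
      funext a
      simp only [assign]
      congr 1
      funext i
      simp only [Finset.piecewise, Finset.mem_insert, update_apply]
      grind
    rw [e]
    by_cases hjE : j ∈ Ess (fun a => f (S.piecewise c a))
    · exact ih.tail ⟨j, hjE, c j, rfl⟩
    -- Assigning to an inessential argument is no legal passage, but it changes nothing.
    · rw [show assign (fun a => f (S.piecewise c a)) j (c j) = fun a => f (S.piecewise c a) from
        funext fun a => (eq_update_of_notMem_Ess hjE a (c j)).symm]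
      exact ih

theorem ess_add_two_le_of_gap (hf : 2 ≤ gap f) {h : Op k n} (hh : SimpleMinor f h) :
    ess h + 2 ≤ ess f := by
  have hle : ess h ≤ sSup (ess '' Mnr f) := by
    refine le_csSup ⟨n, ?_⟩ ⟨h, Relation.TransGen.single hh, rfl⟩
    rintro _ ⟨g, -, rfl⟩
    exact (Finset.card_le_univ _).trans_eq (Fintype.card_fin n)
  unfold gap at hf
  omega

theorem exists_mem_Ess_notMem_identify (hf : 2 ≤ gap f) {p q : Fin n} (hp : p ∈ Ess f)
    (hq : q ∈ Ess f) (hpq : p ≠ q) : ∃ m ∈ Ess f, m ≠ p ∧ m ∉ Ess (identify f p q) := by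
  have hle := ess_add_two_le_of_gap hf ⟨p, hp, q, hq, hpq, rfl⟩
  have hcard : (Ess (identify f p q)).card < ((Ess f).erase p).card := by
    rw [Finset.card_erase_of_mem hp]
    unfold ess at hle
    omega
  obtain ⟨m, hm, hm'⟩ := Finset.exists_mem_notMem_of_card_lt_card hcard
  exact ⟨m, Finset.mem_of_mem_erase hm, Finset.ne_of_mem_erase hm, hm'⟩

/-- The point with given essential coordinates and value `z` at all other ones. -/
noncomputable def extend (f : Op k n) (z : Fin k) (y : Ess f → Fin k) : Fin n → Fin k :=
  fun i => if h : i ∈ Ess f then y ⟨i, h⟩ else z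

theorem extend_coe (z : Fin k) (y : Ess f → Fin k) (i : Ess f) : extend f z y i = y i := by
  simp [extend]

theorem extend_eq {z : Fin k} {x y : Ess f → Fin k} {i : Fin n}
    (h : ∀ hi : i ∈ Ess f, x ⟨i, hi⟩ = y ⟨i, hi⟩) : extend f z x i = extend f z y i := by
  unfold extend
  split_ifs with hi
  · exact h hi
  · rfl

theorem not_misses_extend (z : Fin k) (i : Ess f) : ¬ Misses (fun y => f (extend f z y)) i := by
  obtain ⟨a, b, hab⟩ := exists_of_mem_Ess i.2
  intro h
  have e : ∀ x : Fin n → Fin k, f (extend f z fun j => x j) = f x := fun x =>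
    eq_of_eqOn_Ess fun j hj => extend_coe z _ ⟨j, hj⟩
  refine hab ?_
  rw [← e a, ← e (update a i b)]
  refine h _ _ fun j hj => ?_
  rw [update_of_ne fun hc => hj (Subtype.ext hc)]

/-- Identification loses some essential `m ≠ p` besides `p`: `m = q` gives `BlockFree`, any other
`m` gives `FreeOn`. -/
theorem losesTwo_extend (hf : 2 ≤ gap f) (z : Fin k) :
    LosesTwo (fun y => f (extend f z y)) := by
  rintro ⟨p, hp⟩ ⟨q, hq⟩ hpq
  have hpq' : p ≠ q := fun h => hpq (Subtype.ext h)
  obtain ⟨m, hm, hmp, hmI⟩ := exists_mem_Ess_notMem_identify hf hp hq hpq'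
  have e : ∀ y : Ess f → Fin k, y ⟨p, hp⟩ = y ⟨q, hq⟩ →
      f (extend f z y) = identify f p q (extend f z y) := by
    intro y hy
    rw [identify, show extend f z y q = extend f z y p by
      rw [extend_coe z y ⟨p, hp⟩, extend_coe z y ⟨q, hq⟩, hy], update_eq_self]
  by_cases hmq : m = q
  · subst hmq
    refine Or.inl fun x y hx hy hxy => ?_
    change f _ = f _
    rw [e x hx, e y hy, eq_update_of_notMem_Ess hmI (extend f z x) (y ⟨m, hq⟩)]
    simp only [identify]
    congr 1
    funext i
    by_cases hip : i = p
    · subst hip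
      simp [extend_coe z y ⟨m, hq⟩]
    by_cases hiq : i = m
    · subst hiq
      simp [hip, extend_coe z y ⟨i, hq⟩]
    simp only [update_of_ne hip, update_of_ne hiq]
    exact extend_eq fun hi => hxy _ (by simpa using hip) (by simpa using hiq)
  · refine Or.inr ⟨⟨m, hm⟩, by simpa using hmp, by simpa using hmq, fun x y hx hy hxy => ?_⟩
    change f _ = f _
    rw [e x hx, e y hy, eq_update_of_notMem_Ess hmI (extend f z x) (y ⟨m, hm⟩)]
    congr 1
    funext i
    by_cases him : i = m
    · subst him
      simp [extend_coe z y ⟨i, hm⟩]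
    rw [update_of_ne him]
    exact extend_eq fun hi => hxy _ (by simpa using him)

end Transfer

end KValued

theorem theorem2p5 {k n : ℕ} (hk : 2 ≤ k) (f : KValued.Op k n) (hf : 2 ≤ KValued.gap f) :
    ∀ M : Finset (Fin n), M.Nonempty → M ⊆ KValued.Ess f → KValued.Separable f M := by
  intro M hM hME
  let z : Fin k := ⟨0, by omega⟩
  obtain ⟨i₀, hi₀⟩ := hM
  obtain ⟨c, hc⟩ := (KValued.losesTwo_extend hf z).rich (KValued.not_misses_extend z)
    (M := {i | (i : Fin n) ∈ M}) ⟨⟨i₀, hME hi₀⟩, hi₀⟩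
  refine ⟨⟨i₀, hi₀⟩, hME, _,
    KValued.subfunction_piecewise (KValued.extend f z c) (KValued.Ess f \ M), ?_⟩
  ext i
  refine ⟨fun hi => ?_, fun hi => ?_⟩
  · obtain ⟨a, b, hab⟩ := KValued.exists_of_mem_Ess hi
    by_contra hiM
    refine hab (KValued.eq_of_eqOn_Ess fun j hj => ?_)
    by_cases hjM : j ∈ M
    · have hji : j ≠ i := by rintro rfl; exact hiM hjM
      simp [Finset.piecewise, hjM, hji]
    · simp [Finset.piecewise, hj, hjM]
  · obtain ⟨x, y, hx, hxy, hne⟩ := hc ⟨i, hME hi⟩ hi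
    refine KValued.mem_Ess_of_ne (x := KValued.extend f z x) (y := KValued.extend f z y) ?_ ?_
    · intro j hj
      exact KValued.extend_eq fun hjE => hxy _ (by simpa using hj)
    · have fixed : ∀ w : KValued.Ess f → Fin k, (∀ j : KValued.Ess f, (j : Fin n) ∉ M → w j = c j) →
          (KValued.Ess f \ M).piecewise (KValued.extend f z c) (KValued.extend f z w) =
            KValued.extend f z w := by
        intro w hw
        funext j
        by_cases hj : j ∈ KValued.Ess f \ M
        · rw [Finset.piecewise_eq_of_mem _ _ _ hj]
          exact KValued.extend_eq fun hjE => (hw ⟨j, hjE⟩ (Finset.mem_sdiff.1 hj).2).symm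
        · rw [Finset.piecewise_eq_of_notMem _ _ _ hj]
      change f _ ≠ f _
      rw [fixed x hx, fixed y fun j hj => ?_]
      · exact hne
      · rw [← hx j hj]
        exact (hxy j (by rintro rfl; exact hj hi)).symm
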